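/- Write points of $\mathbb R^n$, $n\ge 1$, as $x=(x',x_n)$ with $x'\in\mathbb R^{n-1}$, and let $B_r$ be the open ball of radius $r$ centred at $0$. For every $n$ and every $\rho>0$ there are constants $C',c'>0$, depending only on $n$ and $\rho$, with the following property. Let $\Omega\subset\mathbb R^n$ be an open convex set with $0\in\partial\Omega$ and $\Omega\subset\{x_n>0\}\cap B_{1/\rho}$, which has an interior tangent ball of radius $\rho$ at the origin (a ball of radius $\rho$ contained in $\Omega$ whose boundary contains $0$). Let $u:\overline\Omega\to\mathbb R$ be continuous and convex with $u\ge 0$, $u(0)=0$, and $\nabla u(0)=0$ in the sense that for no $t>0$ does $u(x)\ge t\,x_n$ hold for all $x\in\overline\Omega$. Suppose that $$\rho|x'|^2\le u(x)\quad\text{for } x\in\partial\Omega,\qquad u(x)\le\frac1\rho|x'|^2\quad\text{for } x\in\partial\Omega\cap B_\rho,$$ and that $\det D^2u\le\frac1\rho$ in $\Omega$ in the sense of Alexandrov, i.e. $\left|\bigcup_{x\in E}\partial u(x)\right|\le\frac1\rho|E|$ for every Borel set $E\subset\Omega$, where $\partial u(x)$ is the subdifferential of $u$ at $x$ and $|\cdot|$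 is Lebesgue measure. Then $$u(x)\le C'|x|^{4/3}\qquad\text{for all } x\in\Omega\cap B_{c'}.$$ In particular this holds if $\rho|x'|^2\le u(x)\le\frac1\rho|x'|^2$ on all of $\partial\Omega$. -/

import Mathlib

open MeasureTheory
open scoped ENNReal

namespace DegenerateMA

/-- The Euclidean space of dimension `n + 1`; the last coordinate is the distinguished one. -/
abbrev Space (n : ℕ) : Type := EuclideanSpace ℝ (Fin (n + 1))

/-- The first `n` coordinates `x'` of `x = (x', xₙ)`, with the Euclidean norm. -/
def tang {n : ℕ} (x : Space n) : EuclideanSpace ℝ (Fin n) :=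
  WithLp.toLp 2 (fun i => x i.castSucc)

/-- The last coordinate `xₙ` of `x = (x', xₙ)`. -/
def height {n : ℕ} (x : Space n) : ℝ := x (Fin.last n)

/-- `Ω` is open and convex, `0 ∈ ∂Ω`, `Ω ⊆ {xₙ > 0} ∩ B_{1/ρ}`, and `Ω` has an interior
tangent ball of radius `ρ` at the origin. -/
structure HypH1 {n : ℕ} (ρ : ℝ) (Ω : Set (Space n)) : Prop where
  isOpen : IsOpen Ω
  convex : Convex ℝ Ω
  zero_mem_frontier : (0 : Space n) ∈ frontier Ω
  subset_halfSpace : ∀ x ∈ Ω, 0 < height x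
  subset_ball : Ω ⊆ Metric.ball 0 (1 / ρ)
  tangent_ball : ∃ z : Space n, dist 0 z = ρ ∧ Metric.ball z ρ ⊆ Ω

/-- `u` is a continuous convex function on the closure of `Ω`, `u ≥ 0`, `u 0 = 0`, and
`∇u(0) = 0` in the sense that for no `t > 0` is the plane `x_{n+1} = t xₙ` a supporting plane
of the graph of `u` at `0`. -/
structure HypH2 {n : ℕ} (Ω : Set (Space n)) (u : Space n → ℝ) : Prop where
  convexOn : ConvexOn ℝ (closure Ω) u
  continuousOn : ContinuousOn u (closure Ω)
  nonneg : ∀ x ∈ closure Ω, 0 ≤ u x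
  map_zero : u 0 = 0
  not_supporting : ∀ t : ℝ, 0 < t → ¬ ∀ x ∈ closure Ω, t * height x ≤ u x

/-- The subdifferential at `x` of a function `u` on `Ω`: the slopes of the supporting planes
of the graph of `u` at `x`. -/
def subdifferential {n : ℕ} (Ω : Set (Space n)) (u : Space n → ℝ) (x : Space n) :
    Set (Space n) :=
  {p | ∀ y ∈ Ω, u x + inner ℝ p (y - x) ≤ u y}

/-- The Monge-Ampère measure (in the sense of Alexandrov) of a convex function `u` on `Ω`:
the set `E` gets the Lebesgue measure of the union of the subdifferentials of `u` at the
points of `E`. -/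
noncomputable def mongeAmpere {n : ℕ} (Ω : Set (Space n)) (u : Space n → ℝ)
    (E : Set (Space n)) : ℝ≥0∞ :=
  volume (⋃ x ∈ E, subdifferential Ω u x)

/-- `det D²u ≤ K` in `Ω`, as an inequality between the Monge-Ampère measure of `u` and `K`
times the Lebesgue measure, on the Borel subsets of `Ω`. -/
def DetHessianLE {n : ℕ} (Ω : Set (Space n)) (u : Space n → ℝ) (K : ℝ) : Prop :=
  ∀ E : Set (Space n), MeasurableSet E → E ⊆ Ω →
    mongeAmpere Ω u E ≤ ENNReal.ofReal K * volume E

end DegenerateMA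

/-!
The function `u` is compared with quadratic polynomials whose Hessian determinant exceeds the bound
on `det D²u`: such a polynomial cannot touch `u` from below at an interior point, so it stays
below `u` as soon as it does so on the boundary.

Barriers of this kind propagate the lower bound `ρ|x'|² - M xₙ ≤ u` from `|x'| ≤ r` to
`|x'| ≤ r / 64` with `M / 8` in place of `M`, so on `|x'| ≤ q²` the slope can be taken of order `q`.
If `u` exceeded `ρq⁴ / 2` at every point of height about `q³`, this lower bound would leave room for
a barrier with positive slope at the origin, which `∇u(0) = 0` forbids. Hence `u(y) ≤ ρq⁴ / 2` for
some `y` with `|y'| ≤ q²` and `yₙ` of order `q³`. A point `x` with `|x|` at most a small multiple of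
`q³` lies on a segment from `y` to a boundary point `z` with `|z'| ≤ 2q²`, so convexity and the
upper boundary bound give `u(x) ≤ C q⁴`.
-/

namespace DegenerateMA

variable {n : ℕ}

section Comparison

variable {Ω D : Set (Space n)} {u v : Space n → ℝ}

theorem subdifferential_subset_biUnion_of_le_frontier (hD : IsOpen D)
    (hbdd : Bornology.IsBounded D) (hDΩ : D ⊆ Ω) (hconv : ConvexOn ℝ Ω u)
    (hcont : ContinuousOn u (closure D)) (hfr : ∀ x ∈ frontier D, v x ≤ u x) {x₀ : Space n}
    (hx₀ : x₀ ∈ D) (hlt₀ : u x₀ < v x₀) :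
    subdifferential (closure D) v x₀ ⊆ ⋃ x ∈ {x ∈ D | u x < v x}, subdifferential Ω u x := by
  intro p hp
  -- Lower the supporting plane of `v` at `x₀` until it touches the graph of `u` from below.
  obtain ⟨x₁, hx₁, hmin⟩ := hbdd.isCompact_closure.exists_isMinOn ⟨x₀, subset_closure hx₀⟩
    (f := fun x => u x - inner ℝ p x) (hcont.sub (by fun_prop))
  have hlt₁ : u x₁ < v x₁ := by
    have h₀ : u x₁ - inner ℝ p x₁ ≤ u x₀ - inner ℝ p x₀ := hmin (subset_closure hx₀)
    have h₁ := hp x₁ hx₁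
    rw [inner_sub_right] at h₁
    linarith
  have hx₁D : x₁ ∈ D := by
    rcases closure_eq_self_union_frontier D ▸ hx₁ with h | h
    · exact h
    · exact absurd (hfr x₁ h) hlt₁.not_ge
  have hglobal : IsMinOn (fun x => u x - inner ℝ p x) Ω x₁ :=
    IsMinOn.of_isLocalMinOn_of_convexOn (hDΩ hx₁D)
      ((hmin.isLocalMin (Filter.mem_of_superset (hD.mem_nhds hx₁D) subset_closure)).on Ω)
      (hconv.sub ((innerSL ℝ p).toLinearMap.concaveOn hconv.1))
  refine Set.mem_biUnion (show x₁ ∈ {x ∈ D | u x < v x} from ⟨hx₁D, hlt₁⟩) fun y hy => ?_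
  have hy' : u x₁ - inner ℝ p x₁ ≤ u y - inner ℝ p y := hglobal hy
  rw [inner_sub_right]
  linarith

theorem mongeAmpere_le_of_le_frontier (hD : IsOpen D)
    (hbdd : Bornology.IsBounded D) (hDΩ : D ⊆ Ω) (hconv : ConvexOn ℝ Ω u)
    (hcont : ContinuousOn u (closure D)) (hfr : ∀ x ∈ frontier D, v x ≤ u x) :
    mongeAmpere (closure D) v {x ∈ D | u x < v x} ≤ mongeAmpere Ω u {x ∈ D | u x < v x} :=
  measure_mono <| Set.iUnion₂_subset fun _ hx =>
    subdifferential_subset_biUnion_of_le_frontier hD hbdd hDΩ hconv hcont hfr hx.1 hx.2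

theorem le_of_le_frontier_of_lt_mongeAmpere {K : ℝ} (hD : IsOpen D)
    (hbdd : Bornology.IsBounded D) (hDΩ : D ⊆ Ω) (hconv : ConvexOn ℝ Ω u)
    (hcont : ContinuousOn u (closure D)) (hv : ContinuousOn v D) (hdet : DetHessianLE Ω u K)
    (hK : ∀ E ⊆ D, IsOpen E → E.Nonempty →
      ENNReal.ofReal K * volume E < mongeAmpere (closure D) v E)
    (hfr : ∀ x ∈ frontier D, v x ≤ u x) {x : Space n} (hx : x ∈ closure D) : v x ≤ u x := by
  rcases closure_eq_self_union_frontier D ▸ hx with hxD | hxF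
  · by_contra! hlt
    have hopen : IsOpen {x ∈ D | u x < v x} := by
      have := ((hcont.mono subset_closure).sub hv).isOpen_inter_preimage hD (isOpen_Iio (a := 0))
      simpa only [Set.preimage, Set.inter_def, Set.mem_Iio, Pi.sub_apply, sub_neg,
        Set.mem_ofPred_eq] using this
    have hsub : {x ∈ D | u x < v x} ⊆ D := Set.sep_subset D _
    exact ((hK _ hsub hopen ⟨x, hxD, hlt⟩).trans_le
      (mongeAmpere_le_of_le_frontier hD hbdd hDΩ hconv hcont hfr)).not_ge
      (hdet _ hopen.measurableSet (hsub.trans hDΩ))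
  · exact hfr x hxF

end Comparison

section Quadratic

/-- The quadratic polynomial with value `c` and gradient `b` at the origin and with constant
Hessian `T`. These polynomials are the barriers of the comparison argument. -/
noncomputable def quadratic (T : Space n →ₗ[ℝ] Space n) (b : Space n) (c : ℝ) (x : Space n) : ℝ :=
  c + inner ℝ b x + inner ℝ (T x) x / 2

variable {T : Space n →ₗ[ℝ] Space n}

theorem continuous_quadratic (T : Space n →ₗ[ℝ] Space n) (b : Space n) (c : ℝ) :
    Continuous (quadratic T b c) := by
  have hT : Continuous T := T.continuous_of_finiteDimensional
  unfold quadratic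
  fun_prop

theorem add_apply_mem_subdifferential_quadratic (hT : T.IsPositive) (b : Space n) (c : ℝ)
    (S : Set (Space n)) (x : Space n) : b + T x ∈ subdifferential S (quadratic T b c) x := by
  intro y _
  have hsymm : inner ℝ (T y) x = inner ℝ (T x) y := by rw [hT.1 y x, real_inner_comm]
  have htaylor : quadratic T b c y - (quadratic T b c x + inner ℝ (b + T x) (y - x)) =
      inner ℝ (T (y - x)) (y - x) / 2 := by
    simp only [quadratic, map_sub, inner_add_left, inner_sub_left, inner_sub_right, hsymm]
    ring
  have hnonneg : 0 ≤ inner ℝ (T (y - x)) (y - x) := hT.2 (y - x)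
  linarith

open scoped Pointwise in
theorem det_mul_volume_le_mongeAmpere_quadratic (hT : T.IsPositive) (b : Space n) (c : ℝ)
    (S E : Set (Space n)) :
    ENNReal.ofReal (LinearMap.det T) * volume E ≤ mongeAmpere S (quadratic T b c) E := by
  calc ENNReal.ofReal (LinearMap.det T) * volume E
      ≤ ENNReal.ofReal |LinearMap.det T| * volume E := by gcongr; exact le_abs_self _
    _ = volume (b +ᵥ T '' E) := by rw [measure_vadd, Measure.addHaar_image_linearMap]
    _ ≤ mongeAmpere S (quadratic T b c) E := by
      refine measure_mono ?_
      rintro _ ⟨_, ⟨x, hx, rfl⟩, rfl⟩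
      exact Set.mem_biUnion hx (add_apply_mem_subdifferential_quadratic hT b c S x)

theorem quadratic_le_of_le_frontier {Ω D : Set (Space n)} {u : Space n → ℝ} {K : ℝ}
    (hT : T.IsPositive) (hK : 0 ≤ K) (hKT : K < LinearMap.det T) {b : Space n} {c : ℝ}
    (hD : IsOpen D) (hbdd : Bornology.IsBounded D) (hDΩ : D ⊆ Ω) (hconv : ConvexOn ℝ Ω u)
    (hcont : ContinuousOn u (closure D)) (hdet : DetHessianLE Ω u K)
    (hfr : ∀ x ∈ frontier D, quadratic T b c x ≤ u x) {x : Space n} (hx : x ∈ closure D) :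
    quadratic T b c x ≤ u x := by
  refine le_of_le_frontier_of_lt_mongeAmpere hD hbdd hDΩ hconv hcont
    (continuous_quadratic T b c).continuousOn hdet (fun E hED hE hne => ?_) hfr hx
  refine lt_of_lt_of_le ?_ (det_mul_volume_le_mongeAmpere_quadratic hT b c _ E)
  exact ENNReal.mul_lt_mul_left (hE.measure_pos volume hne).ne'
    (hbdd.subset hED).measure_lt_top.ne
    ((ENNReal.ofReal_lt_ofReal_iff (hK.trans_lt hKT)).mpr hKT)

end Quadratic

section Coordinates

theorem tang_add (x y : Space n) : tang (x + y) = tang x + tang y := rfl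

theorem tang_sub (x y : Space n) : tang (x - y) = tang x - tang y := rfl

theorem tang_smul (c : ℝ) (x : Space n) : tang (c • x) = c • tang x := rfl

theorem height_add (x y : Space n) : height (x + y) = height x + height y := rfl

theorem height_sub (x y : Space n) : height (x - y) = height x - height y := rfl

theorem height_smul (c : ℝ) (x : Space n) : height (c • x) = c * height x := rfl

theorem continuous_tang : Continuous (tang : Space n → EuclideanSpace ℝ (Fin n)) := by
  unfold tang
  fun_prop

theorem continuous_height : Continuous (height : Space n → ℝ) := by
  unfold height
  fun_prop

theorem inner_eq_inner_tang_add_height_mul (x y : Space n) :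
    inner ℝ x y = inner ℝ (tang x) (tang y) + height x * height y := by
  simp [PiLp.inner_apply, Fin.sum_univ_castSucc, tang, height, mul_comm]

theorem norm_sq_eq_norm_tang_sq_add_height_sq (x : Space n) :
    ‖x‖ ^ 2 = ‖tang x‖ ^ 2 + height x ^ 2 := by
  rw [← real_inner_self_eq_norm_sq, inner_eq_inner_tang_add_height_mul,
    real_inner_self_eq_norm_sq, sq (height x)]

theorem norm_tang_le (x : Space n) : ‖tang x‖ ≤ ‖x‖ :=
  le_of_sq_le_sq (by
    rw [norm_sq_eq_norm_tang_sq_add_height_sq x]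
    exact le_add_of_nonneg_right (sq_nonneg _)) (norm_nonneg _)

theorem height_le_norm (x : Space n) : height x ≤ ‖x‖ :=
  le_of_sq_le_sq (by
    rw [norm_sq_eq_norm_tang_sq_add_height_sq x]
    exact le_add_of_nonneg_left (sq_nonneg _)) (norm_nonneg _)

theorem norm_le_norm_tang_add_abs_height (x : Space n) : ‖x‖ ≤ ‖tang x‖ + |height x| := by
  refine le_of_sq_le_sq ?_ (by positivity)
  rw [norm_sq_eq_norm_tang_sq_add_height_sq, add_sq, sq_abs]
  linarith [mul_nonneg (norm_nonneg (tang x)) (abs_nonneg (height x))]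

/-- The point `(w, β)` of `ℝⁿ⁺¹ = ℝⁿ × ℝ`. -/
noncomputable def point (w : EuclideanSpace ℝ (Fin n)) (β : ℝ) : Space n :=
  WithLp.toLp 2 (Fin.snoc (α := fun _ => ℝ) w β)

theorem tang_point (w : EuclideanSpace ℝ (Fin n)) (β : ℝ) : tang (point w β) = w := by
  ext i
  simp [tang, point]

theorem height_point (w : EuclideanSpace ℝ (Fin n)) (β : ℝ) : height (point w β) = β := by
  simp [height, point]

/-- The linear map `(x', xₙ) ↦ (a x', A xₙ)`, used as the Hessian of the barriers. -/
noncomputable def stretch (n : ℕ) (a A : ℝ) : Space n →ₗ[ℝ] Space n :=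
  Matrix.toEuclideanLin (Matrix.diagonal (Fin.snoc (α := fun _ => ℝ) (fun _ => a) A))

theorem tang_stretch (a A : ℝ) (x : Space n) : tang (stretch n a A x) = a • tang x := by
  ext i
  simp [stretch, tang, Matrix.mulVec_diagonal]

theorem height_stretch (a A : ℝ) (x : Space n) : height (stretch n a A x) = A * height x := by
  simp [stretch, height, Matrix.mulVec_diagonal]

theorem det_stretch (a A : ℝ) : LinearMap.det (stretch n a A) = a ^ n * A := by
  rw [stretch, Matrix.toEuclideanLin_eq_toLin_orthonormal, LinearMap.det_toLin,
    Matrix.det_diagonal, Fin.prod_univ_castSucc]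
  simp

theorem isPositive_stretch {a A : ℝ} (ha : 0 ≤ a) (hA : 0 ≤ A) : (stretch n a A).IsPositive := by
  rw [stretch, Matrix.isPositive_toEuclideanLin_iff, Matrix.posSemidef_diagonal_iff]
  intro i
  induction i using Fin.lastCases <;> simpa

theorem quadratic_stretch (a A : ℝ) (w : EuclideanSpace ℝ (Fin n)) (β c : ℝ) (x : Space n) :
    quadratic (stretch n (2 * a) (2 * A)) (point w β) c x =
      c + inner ℝ w (tang x) + β * height x + a * ‖tang x‖ ^ 2 + A * height x ^ 2 := by
  rw [quadratic, inner_eq_inner_tang_add_height_mul, inner_eq_inner_tang_add_height_mul,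
    tang_point, height_point, tang_stretch, height_stretch, real_inner_smul_left,
    real_inner_self_eq_norm_sq]
  ring

/-- The cylinder `|x'| < r`, `xₙ < s`, to which the comparison principle is localised. -/
def cylinder (n : ℕ) (r s : ℝ) : Set (Space n) :=
  {x | ‖tang x‖ < r ∧ height x < s}

theorem isOpen_cylinder (r s : ℝ) : IsOpen (cylinder n r s) :=
  (isOpen_lt continuous_tang.norm continuous_const).inter
    (isOpen_lt continuous_height continuous_const)

theorem closure_cylinder_subset (r s : ℝ) :
    closure (cylinder n r s) ⊆ {x | ‖tang x‖ ≤ r ∧ height x ≤ s} :=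
  closure_minimal (fun _ hx => ⟨hx.1.le, hx.2.le⟩) <|
    (isClosed_le continuous_tang.norm continuous_const).inter
      (isClosed_le continuous_height continuous_const)

theorem mem_frontier_inter_cylinder {Ω : Set (Space n)} {r s : ℝ} {x : Space n}
    (hx : x ∈ frontier (Ω ∩ cylinder n r s)) :
    x ∈ closure Ω ∧ ‖tang x‖ ≤ r ∧ height x ≤ s ∧
      (x ∈ frontier Ω ∨ ‖tang x‖ = r ∨ height x = s) := by
  have hxcl := closure_inter_subset (frontier_subset_closure hx)
  obtain ⟨hr, hs⟩ := closure_cylinder_subset r s hxcl.2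
  refine ⟨hxcl.1, hr, hs, ?_⟩
  rcases frontier_inter_subset _ _ hx with h | h
  · exact .inl h.1
  · rw [(isOpen_cylinder r s).frontier_eq] at h
    by_contra! hne
    exact h.2.2 ⟨hr.lt_of_ne hne.2.1, hs.lt_of_ne hne.2.2⟩

end Coordinates

section Domain

variable {ρ : ℝ} {Ω : Set (Space n)} {u : Space n → ℝ}

theorem HypH1.zero_mem_closure (h : HypH1 ρ Ω) : (0 : Space n) ∈ closure Ω :=
  frontier_subset_closure h.zero_mem_frontier

theorem HypH1.isBounded (h : HypH1 ρ Ω) : Bornology.IsBounded Ω :=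
  Metric.isBounded_ball.subset h.subset_ball

theorem HypH1.height_nonneg (h : HypH1 ρ Ω) {x : Space n} (hx : x ∈ closure Ω) : 0 ≤ height x :=
  closure_minimal (fun y hy => (h.subset_halfSpace y hy).le)
    (isClosed_le continuous_const continuous_height) hx

theorem HypH1.height_le (h : HypH1 ρ Ω) {x : Space n} (hx : x ∈ closure Ω) :
    height x ≤ 1 / ρ := by
  have hmem : x ∈ Metric.closedBall 0 (1 / ρ) :=
    Metric.closure_ball_subset_closedBall (closure_mono h.subset_ball hx)
  exact (height_le_norm x).trans (mem_closedBall_zero_iff.mp hmem)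

theorem HypH1.lt_one (h : HypH1 ρ Ω) (hρ : 0 < ρ) : ρ < 1 := by
  obtain ⟨z, hz, hball⟩ := h.tangent_ball
  have hcenter := h.subset_ball (hball (Metric.mem_ball_self hρ))
  rw [Metric.mem_ball, dist_comm, hz, lt_div_iff₀ hρ] at hcenter
  nlinarith

theorem HypH1.exists_center (h : HypH1 ρ Ω) (hρ : 0 < ρ) :
    ∃ z : Space n, tang z = 0 ∧ height z = ρ ∧ Metric.ball z ρ ⊆ Ω := by
  obtain ⟨z, hz, hball⟩ := h.tangent_ball
  rw [dist_zero_left] at hz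
  have hbottom : z - point 0 ρ ∈ closure (Metric.ball z ρ) := by
    have hnorm : ‖(point 0 ρ : Space n)‖ ≤ ρ := by
      refine (norm_le_norm_tang_add_abs_height _).trans_eq ?_
      rw [tang_point, height_point, norm_zero, zero_add, abs_of_pos hρ]
    rwa [closure_ball z hρ.ne', Metric.mem_closedBall, dist_eq_norm, sub_sub_cancel_left, norm_neg]
  have hheight : ρ ≤ height z := by
    have := h.height_nonneg (closure_mono hball hbottom)
    rwa [height_sub, height_point, sub_nonneg] at this
  have heq : height z = ρ := le_antisymm (hz ▸ height_le_norm z) hheight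
  refine ⟨z, ?_, heq, hball⟩
  have hpyth := norm_sq_eq_norm_tang_sq_add_height_sq z
  rw [hz, heq, right_eq_add] at hpyth
  simpa using hpyth

theorem HypH1.mul_height_le_norm_tang_sq (h : HypH1 ρ Ω) (hρ : 0 < ρ) {x : Space n}
    (hx : x ∈ frontier Ω) (hxρ : height x ≤ ρ) : ρ * height x ≤ ‖tang x‖ ^ 2 := by
  obtain ⟨z, hz, hzρ, hball⟩ := h.exists_center hρ
  have hdist : ρ ≤ ‖x - z‖ := by
    rw [h.isOpen.frontier_eq] at hx
    simpa [dist_eq_norm] using fun hmem => hx.2 (hball hmem)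
  have hsq : ρ ^ 2 ≤ ‖tang x‖ ^ 2 + (height x - ρ) ^ 2 := by
    have hpyth := norm_sq_eq_norm_tang_sq_add_height_sq (x - z)
    rw [tang_sub, hz, sub_zero, height_sub, hzρ] at hpyth
    rw [← hpyth]
    gcongr
  have h0 := h.height_nonneg (frontier_subset_closure hx)
  nlinarith [mul_nonneg h0 (sub_nonneg.mpr hxρ)]

theorem HypH2.exists_lt_mul_height_of_mem_nhds (h : HypH2 Ω u) (h0 : (0 : Space n) ∈ closure Ω)
    {U : Set (Space n)} (hU : U ∈ nhds 0) {t : ℝ} (ht : 0 < t) :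
    ∃ x ∈ closure Ω ∩ U, u x < t * height x := by
  by_contra! hle
  have hlin : inner ℝ (point 0 t : Space n) = fun x => t * height x := by
    ext x
    rw [inner_eq_inner_tang_add_height_mul, tang_point, height_point, inner_zero_left, zero_add]
  have hconv : ConvexOn ℝ (closure Ω) (fun x => u x - t * height x) := by
    have := (innerSL ℝ (point 0 t : Space n)).toLinearMap.concaveOn h.convexOn.1
    exact h.convexOn.sub (hlin ▸ this)
  have hzero : u 0 - t * height (0 : Space n) = 0 := by simp [h.map_zero, height]
  have hlocal : IsLocalMinOn (fun x => u x - t * height x) (closure Ω) 0 := by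
    filter_upwards [self_mem_nhdsWithin, mem_nhdsWithin_of_mem_nhds hU] with x hx hxU
    rw [hzero, sub_nonneg]
    exact hle x ⟨hx, hxU⟩
  refine h.not_supporting t ht fun x hx => ?_
  have hmin : u 0 - t * height (0 : Space n) ≤ u x - t * height x :=
    IsMinOn.of_isLocalMinOn_of_convexOn h0 hlocal hconv hx
  rwa [hzero, sub_nonneg] at hmin

end Domain

section LowerBound

variable {ρ κ K a A r M : ℝ} {Ω : Set (Space n)} {u : Space n → ℝ}

/-- `u ≥ κ |x'|² - M xₙ` on the part of `closure Ω` where `|x'| ≤ r`. Propagating this bound to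
small `r` with `M` of order `√r` is the first half of the proof. -/
def LowerBound (κ : ℝ) (Ω : Set (Space n)) (u : Space n → ℝ) (r M : ℝ) : Prop :=
  ∀ x ∈ closure Ω, ‖tang x‖ ≤ r → κ * ‖tang x‖ ^ 2 - M * height x ≤ u x

theorem LowerBound.mono (h1 : HypH1 ρ Ω) (h : LowerBound κ Ω u r M) {r' M' : ℝ} (hr : r' ≤ r)
    (hM : M ≤ M') : LowerBound κ Ω u r' M' := fun x hx hxr =>
  (sub_le_sub_left (mul_le_mul_of_nonneg_right hM (h1.height_nonneg hx)) _).trans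
    (h x hx (hxr.trans hr))

/-- The barrier agrees with `κ |x'|² - M xₙ + A xₙ²` where `x' = x₀'`, and its tangential Hessian
is lowered from `2κ` to `2a`. -/
theorem sub_mul_height_le_of_le_frontier (h1 : HypH1 ρ Ω) (h2 : HypH2 Ω u)
    (hdet : DetHessianLE Ω u K) (ha : 0 ≤ a) (hA : 0 ≤ A) (hK0 : 0 ≤ K)
    (hK : K < (2 * a) ^ n * (2 * A)) {D : Set (Space n)} (hD : IsOpen D) (hDΩ : D ⊆ Ω)
    {x₀ : Space n} (hx₀ : x₀ ∈ closure D)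
    (hfr : ∀ x ∈ frontier D, κ * ‖tang x‖ ^ 2 - (κ - a) * ‖tang x - tang x₀‖ ^ 2
      - M * height x + A * height x ^ 2 ≤ u x) :
    κ * ‖tang x₀‖ ^ 2 - M * height x₀ ≤ u x₀ := by
  set barrier := quadratic (stretch n (2 * a) (2 * A))
    (point ((2 * (κ - a)) • tang x₀) (-M)) (-(κ - a) * ‖tang x₀‖ ^ 2)
  have hbarrier (x : Space n) : barrier x = κ * ‖tang x‖ ^ 2
      - (κ - a) * ‖tang x - tang x₀‖ ^ 2 - M * height x + A * height x ^ 2 := by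
    refine (quadratic_stretch _ _ _ _ _ x).trans ?_
    rw [norm_sub_sq_real, real_inner_smul_left, real_inner_comm]
    ring
  have hle : barrier x₀ ≤ u x₀ :=
    quadratic_le_of_le_frontier (isPositive_stretch (by positivity) (by positivity)) hK0
      (hK.trans_eq (det_stretch _ _).symm) hD (h1.isBounded.subset hDΩ) hDΩ
      (h2.convexOn.subset subset_closure h1.convex) (h2.continuousOn.mono (closure_mono hDΩ)) hdet
      (fun x hx => (hbarrier x).trans_le (hfr x hx)) hx₀
  rw [hbarrier, sub_self, norm_zero] at hle
  linarith [mul_nonneg hA (sq_nonneg (height x₀))]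

theorem lowerBound_of_div_le (h1 : HypH1 ρ Ω) (h2 : HypH2 Ω u) (hκ : 0 ≤ κ)
    (hlow : ∀ x ∈ frontier Ω, κ * ‖tang x‖ ^ 2 ≤ u x) (hdet : DetHessianLE Ω u K) (hA : 0 ≤ A)
    (hK0 : 0 ≤ K) (hK : K < (2 * (κ / 32)) ^ n * (2 * A)) (hM : A / ρ ≤ M) (r : ℝ) :
    LowerBound κ Ω u r M := by
  intro x₀ hx₀ _
  refine sub_mul_height_le_of_le_frontier h1 h2 hdet (by positivity) hA hK0 hK h1.isOpen
    subset_rfl hx₀ fun x hx => ?_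
  have hxcl := frontier_subset_closure hx
  have hAM : A * height x ≤ M :=
    (mul_le_mul_of_nonneg_left (h1.height_le hxcl) hA).trans (by rwa [mul_one_div])
  have hdist : 0 ≤ (κ - κ / 32) * ‖tang x - tang x₀‖ ^ 2 :=
    mul_nonneg (by linarith) (sq_nonneg _)
  linarith [hlow x hx, mul_le_mul_of_nonneg_right hAM (h1.height_nonneg hxcl), sq (height x)]

/-- The constants satisfy `(1 - 1/32) (1 - 1/64)² ≥ 1 - 1/16`, so that on the lateral boundary the
barrier is at most the average of `0` and the old lower bound with weights `15/16` and `1/16`. -/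
theorem barrier_le_of_norm_tang_eq (hκ : 0 ≤ κ) (hr : 0 ≤ r) {x x₀ : Space n}
    (hnonneg : 0 ≤ u x) (hold : κ * r ^ 2 - M * height x ≤ u x) (hxr : ‖tang x‖ = r)
    (hx₀ : ‖tang x₀‖ ≤ r / 64) (hquad : A * height x ^ 2 ≤ M / 16 * height x) :
    κ * ‖tang x‖ ^ 2 - (κ - κ / 32) * ‖tang x - tang x₀‖ ^ 2
      - M / 8 * height x + A * height x ^ 2 ≤ u x := by
  have hdist : 63 / 64 * r ≤ ‖tang x - tang x₀‖ := by
    linarith [norm_sub_norm_le (tang x) (tang x₀)]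
  have hloss : 15 / 16 * (κ * r ^ 2) ≤ (κ - κ / 32) * ‖tang x - tang x₀‖ ^ 2 :=
    calc 15 / 16 * (κ * r ^ 2) ≤ (κ - κ / 32) * (63 / 64 * r) ^ 2 := by
          linarith [mul_nonneg hκ (sq_nonneg r)]
      _ ≤ _ := by
          gcongr
          linarith
  rw [hxr]
  linarith

theorem LowerBound.contract (h1 : HypH1 ρ Ω) (h2 : HypH2 Ω u) (hκ : 0 ≤ κ)
    (hlow : ∀ x ∈ frontier Ω, κ * ‖tang x‖ ^ 2 ≤ u x) (hdet : DetHessianLE Ω u K) (hA : 0 < A)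
    (hK0 : 0 ≤ K) (hK : K < (2 * (κ / 32)) ^ n * (2 * A)) (hr : 0 < r) (hM : 0 < M)
    (hMr : 256 * A * κ * r ^ 2 ≤ M ^ 2) (hold : LowerBound κ Ω u r M) :
    LowerBound κ Ω u (r / 64) (M / 8) := by
  intro x₀ hx₀ hx₀r
  -- At the height `s` the linear term of the barrier is twice its quadratic term.
  obtain ⟨s, hs, hAs⟩ : ∃ s, 0 < s ∧ A * s = M / 16 :=
    ⟨M / 16 / A, by positivity, mul_div_cancel₀ _ hA.ne'⟩
  have hκs : κ * r ^ 2 ≤ M / 16 * s := by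
    refine le_of_mul_le_mul_left ?_ hA
    calc A * (κ * r ^ 2) ≤ (M / 16) ^ 2 := by linarith
      _ = A * (M / 16 * s) := by rw [← hAs]; ring
  rcases lt_or_ge (height x₀) s with hx₀s | hx₀s
  · refine sub_mul_height_le_of_le_frontier h1 h2 hdet (by positivity) hA.le hK0 hK
      (h1.isOpen.inter (isOpen_cylinder r s)) Set.inter_subset_left
      ((isOpen_cylinder r s).closure_inter ⟨hx₀, by linarith, hx₀s⟩) fun x hx => ?_
    obtain ⟨hxcl, hxr, hxs, hcases⟩ := mem_frontier_inter_cylinder hx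
    have h0 := h1.height_nonneg hxcl
    have hquad : A * height x ^ 2 ≤ M / 16 * height x :=
      calc A * height x ^ 2 = A * height x * height x := by ring
        _ ≤ A * s * height x := by gcongr
        _ = M / 16 * height x := by rw [hAs]
    have hdist : 0 ≤ (κ - κ / 32) * ‖tang x - tang x₀‖ ^ 2 :=
      mul_nonneg (by linarith) (sq_nonneg _)
    rcases hcases with hbase | hlateral | htop
    · linarith [hlow x hbase, mul_nonneg hM.le h0]
    · exact barrier_le_of_norm_tang_eq hκ hr.le (h2.nonneg x hxcl)
        (hlateral ▸ hold x hxcl hxr) hlateral hx₀r hquad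
    · have hbound : κ * ‖tang x‖ ^ 2 ≤ κ * r ^ 2 := by gcongr
      rw [htop] at hquad ⊢
      linarith [h2.nonneg x hxcl]
  · have hbound : κ * ‖tang x₀‖ ^ 2 ≤ κ * r ^ 2 := by
      gcongr
      linarith
    have hheight : M / 16 * s ≤ M / 16 * height x₀ := by gcongr
    linarith [h2.nonneg x₀ hx₀, mul_nonneg hM.le (hs.le.trans hx₀s)]

theorem lowerBound_sq (h1 : HypH1 ρ Ω) (h2 : HypH2 Ω u) (hκ : 0 ≤ κ)
    (hlow : ∀ x ∈ frontier Ω, κ * ‖tang x‖ ^ 2 ≤ u x) (hdet : DetHessianLE Ω u K) (hA : 0 < A)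
    (hK0 : 0 ≤ K) (hK : K < (2 * (κ / 32)) ^ n * (2 * A)) (hM : 0 < M) (hAM : A / ρ ≤ M)
    (hAM' : 256 * A * κ ≤ M ^ 2) {q : ℝ} (hq0 : 0 < q) (hq1 : q ≤ 1) :
    LowerBound κ Ω u (q ^ 2) (8 * M * q) := by
  have hdyadic (j : ℕ) : LowerBound κ Ω u (((1 / 8) ^ j) ^ 2) (M * (1 / 8) ^ j) := by
    induction j with
    | zero => exact lowerBound_of_div_le h1 h2 hκ hlow hdet hA.le hK0 hK (by simpa using hAM) _
    | succ j ih =>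
      have hp1 : ((1 : ℝ) / 8) ^ j ≤ 1 := pow_le_one₀ (by norm_num) (by norm_num)
      rw [pow_succ (1 / 8 : ℝ) j]
      set p : ℝ := (1 / 8) ^ j
      have hcond : 256 * A * κ * (p ^ 2) ^ 2 ≤ (M * p) ^ 2 :=
        calc 256 * A * κ * (p ^ 2) ^ 2 ≤ M ^ 2 * (p ^ 2 * 1) := by
              rw [sq (p ^ 2)]
              gcongr
              exact pow_le_one₀ (by positivity) hp1
          _ = (M * p) ^ 2 := by ring
      convert ih.contract h1 h2 hκ hlow hdet hA hK0 hK (by positivity) (by positivity) hcond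
        using 1 <;> ring
  obtain ⟨j, hj, hj'⟩ := exists_nat_pow_near_of_lt_one hq0 hq1 (y := (1 / 8 : ℝ)) (by norm_num)
    (by norm_num)
  refine (hdyadic j).mono h1 (by gcongr) ?_
  rw [pow_succ] at hj
  calc M * (1 / 8) ^ j ≤ M * (8 * q) := by gcongr; linarith
    _ = 8 * M * q := by ring

end LowerBound

section UpperBound

variable {ρ κ K A R M δ : ℝ} {Ω : Set (Space n)} {u : Space n → ℝ}

theorem HypH1.tilted_le_of_mem_frontier (h1 : HypH1 ρ Ω) (hρ : 0 < ρ) (hκ : 0 ≤ κ) {t : ℝ}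
    (htρ : t ≤ κ * ρ / 4) (hA : 0 ≤ A) (hδρ : δ ≤ ρ) (hAδ : A * δ ≤ κ * ρ / 4) {x : Space n}
    (hx : x ∈ frontier Ω) (hxδ : height x ≤ δ) :
    t * height x + κ / 32 * ‖tang x‖ ^ 2 + A * height x ^ 2 ≤ κ * ‖tang x‖ ^ 2 := by
  have h0 := h1.height_nonneg (frontier_subset_closure hx)
  have hparaboloid : κ * (ρ * height x) ≤ κ * ‖tang x‖ ^ 2 :=
    mul_le_mul_of_nonneg_left (h1.mul_height_le_norm_tang_sq hρ hx (hxδ.trans hδρ)) hκ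
  have hlinear : t * height x ≤ κ * ρ / 4 * height x := by gcongr
  have hsquare : A * height x ^ 2 ≤ κ * ρ / 4 * height x :=
    calc A * height x ^ 2 = A * height x * height x := by ring
      _ ≤ A * δ * height x := by gcongr
      _ ≤ κ * ρ / 4 * height x := by gcongr
  linarith [mul_nonneg hκ (sq_nonneg ‖tang x‖)]

theorem tilted_le_half_of_mem_cylinder (hM : 0 < M) (hκ : 0 ≤ κ) (hA : 0 ≤ A)
    (hMδ : M * δ = κ * R ^ 2 / 2) (hMR : 2 * A * κ * R ^ 2 ≤ M ^ 2) {t : ℝ}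
    (htM : t ≤ M / 4) {x : Space n} (h0 : 0 ≤ height x) (hxR : ‖tang x‖ ≤ R)
    (hxδ : height x ≤ δ) :
    t * height x + κ / 32 * ‖tang x‖ ^ 2 + A * height x ^ 2 ≤ κ * R ^ 2 / 2 := by
  have hAδ : A * δ ^ 2 ≤ κ * R ^ 2 / 8 := by
    refine le_of_mul_le_mul_left ?_ (pow_pos hM 2)
    calc M ^ 2 * (A * δ ^ 2) = A * (M * δ) ^ 2 := by ring
      _ = 2 * A * κ * R ^ 2 * (κ * R ^ 2 / 8) := by rw [hMδ]; ring
      _ ≤ M ^ 2 * (κ * R ^ 2 / 8) := by gcongr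
  have hlinear : t * height x ≤ M / 4 * δ := by gcongr
  have htang : κ / 32 * ‖tang x‖ ^ 2 ≤ κ / 32 * R ^ 2 := by gcongr
  have hsquare : A * height x ^ 2 ≤ A * δ ^ 2 := by gcongr
  linarith [mul_nonneg hκ (sq_nonneg R)]

/-- If `u` were large at height `δ`, a convex quadratic polynomial with positive slope at the
origin would lie below `u`, against `∇u(0) = 0`. -/
theorem exists_height_eq_and_le (hρ : 0 < ρ) (h1 : HypH1 ρ Ω) (h2 : HypH2 Ω u) (hκ : 0 < κ)
    (hlow : ∀ x ∈ frontier Ω, κ * ‖tang x‖ ^ 2 ≤ u x) (hdet : DetHessianLE Ω u K) (hA : 0 ≤ A)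
    (hK0 : 0 ≤ K) (hK : K < (2 * (κ / 32)) ^ n * (2 * A)) (hR : 0 < R) (hM : 0 < M)
    (hQ : LowerBound κ Ω u R M) (hMδ : M * δ = κ * R ^ 2 / 2) (hMR : 2 * A * κ * R ^ 2 ≤ M ^ 2)
    (hδρ : δ ≤ ρ) (hAδ : A * δ ≤ κ * ρ / 4) :
    ∃ y ∈ closure Ω, height y = δ ∧ u y ≤ κ * R ^ 2 / 2 := by
  by_contra! hlarge
  have hδ : 0 < δ := pos_of_mul_pos_right (hMδ ▸ by positivity) hM.le
  obtain ⟨t, ht, htM, htρ⟩ : ∃ t, 0 < t ∧ t ≤ M / 4 ∧ t ≤ κ * ρ / 4 :=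
    ⟨min (M / 4) (κ * ρ / 4), by positivity, min_le_left _ _, min_le_right _ _⟩
  set barrier := quadratic (stretch n (2 * (κ / 32)) (2 * A)) (point 0 t) 0
  have hbarrier (x : Space n) :
      barrier x = t * height x + κ / 32 * ‖tang x‖ ^ 2 + A * height x ^ 2 := by
    refine (quadratic_stretch _ _ _ _ _ x).trans ?_
    rw [inner_zero_left, add_zero, zero_add]
  have hfrontier : ∀ x ∈ frontier (Ω ∩ cylinder n R δ), barrier x ≤ u x := by
    intro x hx
    rw [hbarrier]
    obtain ⟨hxcl, hxR, hxδ, hcases⟩ := mem_frontier_inter_cylinder hx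
    have hhalf := tilted_le_half_of_mem_cylinder hM hκ.le hA hMδ hMR htM
      (h1.height_nonneg hxcl) hxR hxδ
    rcases hcases with hbase | hlateral | htop
    · exact (h1.tilted_le_of_mem_frontier hρ hκ.le htρ hA hδρ hAδ hbase hxδ).trans (hlow x hbase)
    · have hux := hQ x hxcl hxR
      rw [hlateral] at hux
      linarith [mul_le_mul_of_nonneg_left hxδ hM.le]
    · exact hhalf.trans (hlarge x hxcl htop).le
  have hzero : cylinder n R δ ∈ nhds 0 :=
    (isOpen_cylinder R δ).mem_nhds ⟨(norm_tang_le 0).trans_lt (by simpa using hR),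
      by simpa [height] using hδ⟩
  obtain ⟨x, ⟨hxcl, hxcyl⟩, hlt⟩ :=
    h2.exists_lt_mul_height_of_mem_nhds h1.zero_mem_closure hzero ht
  have hle : barrier x ≤ u x :=
    quadratic_le_of_le_frontier (isPositive_stretch (by positivity) (by positivity)) hK0
      (hK.trans_eq (det_stretch _ _).symm) (h1.isOpen.inter (isOpen_cylinder R δ))
      (h1.isBounded.subset Set.inter_subset_left) Set.inter_subset_left
      (h2.convexOn.subset subset_closure h1.convex)
      (h2.continuousOn.mono (closure_mono Set.inter_subset_left)) hdet hfrontier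
      ((isOpen_cylinder R δ).closure_inter ⟨hxcl, hxcyl⟩)
  have hquad : 0 ≤ κ / 32 * ‖tang x‖ ^ 2 + A * height x ^ 2 := by positivity
  rw [hbarrier] at hle
  linarith

theorem LowerBound.norm_tang_le (h1 : HypH1 ρ Ω) (h2 : HypH2 Ω u) (hκ : 0 < κ) (hR : 0 < R)
    (hQ : LowerBound κ Ω u R M) {y : Space n} (hy : y ∈ closure Ω)
    (huy : u y + M * height y ≤ κ * R ^ 2) : ‖tang y‖ ≤ R := by
  by_contra! hlt
  -- Otherwise the lower bound fails where the segment from `0` to `y` crosses `|x'| = R`.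
  set c := R / ‖tang y‖
  have hc0 : 0 < c := div_pos hR (hR.trans hlt)
  have hc1 : c < 1 := (div_lt_one (hR.trans hlt)).mpr hlt
  have hnorm : ‖tang (c • y)‖ = R := by
    rw [tang_smul, norm_smul, Real.norm_of_nonneg hc0.le, div_mul_cancel₀ _ (hR.trans hlt).ne']
  have hconv : u (c • y) ≤ c * u y := by
    simpa [h2.map_zero] using h2.convexOn.2 hy h1.zero_mem_closure hc0.le
      (sub_nonneg.mpr hc1.le) (add_sub_cancel c 1)
  have hcy : κ * R ^ 2 - M * height (c • y) ≤ u (c • y) :=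
    hnorm ▸ hQ _ (h2.convexOn.1.smul_mem_of_zero_mem h1.zero_mem_closure hy ⟨hc0.le, hc1.le⟩)
      hnorm.le
  rw [height_smul] at hcy
  have hscaled : c * (u y + M * height y) ≤ c * (κ * R ^ 2) := by gcongr
  have hcontr : c * (κ * R ^ 2) < 1 * (κ * R ^ 2) := by gcongr
  linarith

theorem exists_mem_frontier_of_isPreconnected {X : Type*} [TopologicalSpace X] {s t : Set X}
    (hs : IsPreconnected s) (hin : (s ∩ t).Nonempty) (hout : (s \ t).Nonempty) :
    ∃ x ∈ s, x ∈ frontier t := by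
  by_contra! hfr
  have hcover : s ⊆ interior t ∪ (closure t)ᶜ := fun x hx => by
    by_contra hx'
    rw [Set.mem_union, not_or, Set.notMem_compl_iff] at hx'
    exact hfr x hx ⟨hx'.2, hx'.1⟩
  have hdisj : Disjoint (interior t) (closure t)ᶜ :=
    disjoint_compl_right.mono_left (interior_subset.trans subset_closure)
  obtain ⟨x, hxs, hxt⟩ := hin
  obtain ⟨y, hys, hyt⟩ := hout
  have hxint : x ∈ interior t := (hcover hxs).resolve_right (not_not.mpr (subset_closure hxt))
  exact hyt <| interior_subset <| hs.subset_left_of_subset_union isOpen_interior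
    isClosed_closure.isOpen_compl hdisj hcover ⟨x, hxs, hxint⟩ hys

theorem HypH1.exists_frontier_mem_segment (h1 : HypH1 ρ Ω) {x y : Space n} (hx : x ∈ Ω)
    (hxy : 2 * height x ≤ height y) :
    ∃ z ∈ frontier Ω, x ∈ segment ℝ z y ∧ ‖tang z‖ ≤ 2 * ‖tang x‖ + ‖tang y‖ ∧
      height z ≤ height x := by
  have hout : x + (x - y) ∉ Ω := fun hmem => by
    have := h1.subset_halfSpace _ hmem
    rw [height_add, height_sub] at this
    linarith
  obtain ⟨z, hz, hzΩ⟩ := exists_mem_frontier_of_isPreconnected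
    (convex_segment x (x + (x - y))).isPreconnected ⟨x, left_mem_segment ℝ _ _, hx⟩
    ⟨_, right_mem_segment ℝ _ _, hout⟩
  rw [segment_eq_image', add_sub_cancel_left] at hz
  obtain ⟨τ, ⟨hτ0, hτ1⟩, rfl⟩ := hz
  refine ⟨_, hzΩ, ⟨1 / (1 + τ), τ / (1 + τ), by positivity, by positivity, by field_simp, ?_⟩, ?_,
    ?_⟩
  · match_scalars <;> field_simp
    ring
  · calc ‖tang (x + τ • (x - y))‖ ≤ ‖tang x‖ + τ * ‖tang x - tang y‖ := by
          rw [tang_add, tang_smul, tang_sub]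
          exact (norm_add_le _ _).trans_eq (by rw [norm_smul, Real.norm_of_nonneg hτ0])
      _ ≤ ‖tang x‖ + 1 * (‖tang x‖ + ‖tang y‖) := by gcongr; exact norm_sub_le _ _
      _ = 2 * ‖tang x‖ + ‖tang y‖ := by ring
  · rw [height_add, height_smul, height_sub]
    have hneg : height x - height y ≤ 0 := by linarith [h1.subset_halfSpace x hx]
    linarith [mul_nonpos_of_nonneg_of_nonpos hτ0 hneg]

/-- `x` lies on the segment from `y` to a boundary point close to the origin, where `u` is
controlled by the boundary data. -/
theorem le_max_of_norm_le {Λ : ℝ} (h1 : HypH1 ρ Ω) (h2 : HypH2 Ω u) (hΛ : 0 ≤ Λ)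
    (hup : ∀ x ∈ frontier Ω ∩ Metric.ball 0 ρ, u x ≤ Λ * ‖tang x‖ ^ 2) (hRρ : 3 * R < ρ)
    {x y : Space n} (hy : y ∈ closure Ω) (hyR : ‖tang y‖ ≤ R) (hx : x ∈ Ω)
    (hxR : ‖x‖ ≤ R / 2) (hxy : 2 * ‖x‖ ≤ height y) : u x ≤ max (Λ * (2 * R) ^ 2) (u y) := by
  have hxh := height_le_norm x
  obtain ⟨z, hz, hxzy, hzt, hzh⟩ := h1.exists_frontier_mem_segment (y := y) hx (by linarith)
  have hzR : ‖tang z‖ ≤ 2 * R := by linarith [norm_tang_le x]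
  have hzcl := frontier_subset_closure hz
  have hzρ : ‖z‖ < ρ := by
    have hnorm := norm_le_norm_tang_add_abs_height z
    rw [abs_of_nonneg (h1.height_nonneg hzcl)] at hnorm
    linarith [norm_nonneg x]
  have huz : u z ≤ Λ * (2 * R) ^ 2 :=
    (hup z ⟨hz, mem_ball_zero_iff.mpr hzρ⟩).trans (by gcongr)
  exact (h2.convexOn.le_on_segment hzcl hy hxzy).trans (max_le_max_right _ huz)

end UpperBound

section Scaling

/-- `A` makes the Monge-Ampère density of the barriers exceed `1 / ρ`, and `M` is the slope from
which the propagation of `LowerBound` starts. -/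
theorem exists_barrier_constants (n : ℕ) {ρ : ℝ} (hρ : 0 < ρ) :
    ∃ A M : ℝ, 0 < A ∧ 1 ≤ M ∧ 1 / ρ < (2 * (ρ / 32)) ^ n * (2 * A) ∧ A / ρ ≤ M ∧
      256 * A * ρ ≤ M ^ 2 := by
  obtain ⟨A, hA, hAn⟩ : ∃ A : ℝ, 0 < A ∧ (2 * (ρ / 32)) ^ n * A = 1 / ρ :=
    ⟨1 / ρ / (2 * (ρ / 32)) ^ n, by positivity, mul_div_cancel₀ _ (by positivity)⟩
  have hdiv : 0 < A / ρ := by positivity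
  have hmul : 0 < 256 * A * ρ := by positivity
  refine ⟨A, 1 + A / ρ + 256 * A * ρ, hA, by linarith, ?_, by linarith, ?_⟩
  · have hpos : 0 < 1 / ρ := by positivity
    linarith
  · exact (by linarith : 256 * A * ρ ≤ 1 + A / ρ + 256 * A * ρ).trans
      (le_self_pow₀ (by linarith) two_ne_zero)

/-- The point of small `u` at scale `|x'| ≤ q ^ 2`, where the slope of the lower bound is
`8 * M * q`. -/
theorem exists_height_eq_mul_pow_three {ρ K A M q : ℝ} {Ω : Set (Space n)} {u : Space n → ℝ}
    (hρ : 0 < ρ) (h1 : HypH1 ρ Ω) (h2 : HypH2 Ω u)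
    (hlow : ∀ x ∈ frontier Ω, ρ * ‖tang x‖ ^ 2 ≤ u x) (hdet : DetHessianLE Ω u K) (hA : 0 < A)
    (hK0 : 0 ≤ K) (hK : K < (2 * (ρ / 32)) ^ n * (2 * A)) (hM : 1 ≤ M) (hAM : A / ρ ≤ M)
    (hAM' : 256 * A * ρ ≤ M ^ 2) (hq : 0 < q) (hq1 : q ≤ 1) :
    ∃ y ∈ closure Ω, height y = ρ / (16 * M) * q ^ 3 ∧ ‖tang y‖ ≤ q ^ 2 ∧
      u y ≤ ρ * (q ^ 2) ^ 2 / 2 := by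
  have hM0 : 0 < M := one_pos.trans_le hM
  set δ := ρ / (16 * M) * q ^ 3 with hδ
  have hδM : M * δ = ρ * q ^ 3 / 16 := by
    rw [hδ]
    field_simp
  have hMδ : 8 * M * q * δ = ρ * (q ^ 2) ^ 2 / 2 :=
    calc 8 * M * q * δ = 8 * q * (M * δ) := by ring
      _ = ρ * (q ^ 2) ^ 2 / 2 := by rw [hδM]; ring
  have hq3 : q ^ 3 ≤ 1 := pow_le_one₀ hq.le hq1
  have hδρ : δ ≤ ρ :=
    calc δ ≤ M * δ := le_mul_of_one_le_left (by positivity) hM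
      _ ≤ ρ := by rw [hδM]; linarith [mul_le_of_le_one_right hρ.le hq3]
  have hAδ : A * δ ≤ ρ * ρ / 4 :=
    calc A * δ ≤ M * ρ * δ := by gcongr; exact (div_le_iff₀ hρ).mp hAM
      _ = ρ * ρ * q ^ 3 / 16 := by rw [mul_right_comm, hδM]; ring
      _ ≤ ρ * ρ * 1 / 4 := by gcongr; norm_num
      _ = ρ * ρ / 4 := by ring
  have hMR : 2 * A * ρ * (q ^ 2) ^ 2 ≤ (8 * M * q) ^ 2 :=
    calc 2 * A * ρ * (q ^ 2) ^ 2 = 256 * A * ρ * (q ^ 2 * q ^ 2) / 128 := by ring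
      _ ≤ M ^ 2 * (1 * q ^ 2) / 128 := by gcongr; exact pow_le_one₀ hq.le hq1
      _ ≤ (8 * M * q) ^ 2 := by linarith [mul_nonneg (sq_nonneg M) (sq_nonneg q)]
  have hQ := lowerBound_sq h1 h2 hρ.le hlow hdet hA hK0 hK hM0 hAM hAM' hq hq1
  obtain ⟨y, hy, hyδ, huy⟩ := exists_height_eq_and_le hρ h1 h2 hρ hlow hdet hA.le hK0 hK
    (by positivity) (by positivity) hQ hMδ hMR hδρ hAδ
  exact ⟨y, hy, hyδ, hQ.norm_tang_le h1 h2 hρ (by positivity) hy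
    (by rw [hyδ, hMδ]; linarith), huy⟩

theorem exists_forall_le_mul_pow_four (n : ℕ) {ρ : ℝ} (hρ : 0 < ρ) :
    ∃ k : ℝ, 0 < k ∧ ∀ (Ω : Set (Space n)) (u : Space n → ℝ), HypH1 ρ Ω → HypH2 Ω u →
      (∀ x ∈ frontier Ω, ρ * ‖tang x‖ ^ 2 ≤ u x) →
      (∀ x ∈ frontier Ω ∩ Metric.ball 0 ρ, u x ≤ 1 / ρ * ‖tang x‖ ^ 2) →
      DetHessianLE Ω u (1 / ρ) →
      ∀ q : ℝ, 0 < q → q ≤ ρ / 2 → ∀ x ∈ Ω, ‖x‖ ≤ k * q ^ 3 → u x ≤ 4 / ρ * q ^ 4 := by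
  obtain ⟨A, M, hA, hM, hK, hAM, hAM'⟩ := exists_barrier_constants n hρ
  refine ⟨ρ / (16 * M) / 2, by positivity, fun Ω u h1 h2 hlow hup hdet q hq hqρ x hx hxq => ?_⟩
  have hρ1 := h1.lt_one hρ
  obtain ⟨y, hy, hyh, hyR, huy⟩ := exists_height_eq_mul_pow_three hρ h1 h2 hlow hdet hA
    (by positivity) hK hM hAM hAM' hq (by linarith)
  have hxR : ‖x‖ ≤ q ^ 2 / 2 :=
    calc ‖x‖ ≤ ρ / (16 * M) / 2 * q ^ 3 := hxq
      _ ≤ 1 / 2 * q ^ 3 := by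
        gcongr
        exact (div_le_one (by positivity)).mpr (by linarith)
      _ ≤ q ^ 2 / 2 := by linarith [pow_le_pow_of_le_one hq.le (by linarith) (Nat.le_succ 2)]
  have hRρ : 3 * q ^ 2 < ρ :=
    calc 3 * q ^ 2 ≤ 3 * (ρ / 2) ^ 2 := by gcongr
      _ = 3 / 4 * ρ * ρ := by ring
      _ < ρ := by nlinarith
  refine (le_max_of_norm_le h1 h2 (by positivity) hup hRρ hy hyR hx hxR
    (by rw [hyh]; linarith)).trans (max_le (le_of_eq (by ring)) (huy.trans ?_))
  calc ρ * (q ^ 2) ^ 2 / 2 = ρ / 2 * q ^ 4 := by ring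
    _ ≤ 4 / ρ * q ^ 4 := by gcongr <;> linarith

theorem le_mul_rpow_of_forall_le_mul_pow_four {k C q₀ d w : ℝ} (hk : 0 < k) (hd : 0 < d)
    (hdq₀ : d ≤ k * q₀ ^ 3) (hq₀ : 0 ≤ q₀)
    (h : ∀ q, 0 < q → q ≤ q₀ → d ≤ k * q ^ 3 → w ≤ C * q ^ 4) :
    w ≤ C * (1 / k) ^ (4 / 3 : ℝ) * d ^ (4 / 3 : ℝ) := by
  set q : ℝ := (1 / k * d) ^ (1 / 3 : ℝ) with hq
  have hq3 : q ^ 3 = 1 / k * d := by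
    rw [hq, ← Real.rpow_natCast, ← Real.rpow_mul (by positivity)]
    norm_num
  have hq4 : q ^ 4 = (1 / k) ^ (4 / 3 : ℝ) * d ^ (4 / 3 : ℝ) := by
    rw [hq, ← Real.rpow_natCast, ← Real.rpow_mul (by positivity),
      ← Real.mul_rpow (by positivity) hd.le]
    norm_num
  have hkq : k * q ^ 3 = d := by
    rw [hq3]
    field_simp
  have hqq₀ : q ≤ q₀ := le_of_pow_le_pow_left₀ three_ne_zero hq₀ <|
    le_of_mul_le_mul_left (hkq.trans_le hdq₀) hk
  rw [mul_assoc, ← hq4]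
  exact h q (by positivity) hqq₀ hkq.ge

end Scaling

end DegenerateMA

theorem proposition3p3 (n : ℕ) (ρ : ℝ) (hρ : 0 < ρ) :
    ∃ C' c' : ℝ, 0 < C' ∧ 0 < c' ∧
      ∀ (Ω : Set (DegenerateMA.Space n)) (u : DegenerateMA.Space n → ℝ),
        DegenerateMA.HypH1 ρ Ω →
        DegenerateMA.HypH2 Ω u →
        (∀ x ∈ frontier Ω, ρ * ‖DegenerateMA.tang x‖ ^ 2 ≤ u x) →
        (∀ x ∈ frontier Ω ∩ Metric.ball 0 ρ, u x ≤ 1 / ρ * ‖DegenerateMA.tang x‖ ^ 2) →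
        DegenerateMA.DetHessianLE Ω u (1 / ρ) →
        ∀ x ∈ Ω ∩ Metric.ball 0 c', u x ≤ C' * ‖x‖ ^ (4 / 3 : ℝ) := by
  obtain ⟨k, hk, hscale⟩ := DegenerateMA.exists_forall_le_mul_pow_four n hρ
  refine ⟨4 / ρ * (1 / k) ^ (4 / 3 : ℝ), k * (ρ / 2) ^ 3, by positivity, by positivity, ?_⟩
  rintro Ω u h1 h2 hlow hup hdet x ⟨hx, hxc⟩
  have hx0 : 0 < ‖x‖ := (h1.subset_halfSpace x hx).trans_le (DegenerateMA.height_le_norm x)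
  exact DegenerateMA.le_mul_rpow_of_forall_le_mul_pow_four hk hx0
    (mem_ball_zero_iff.mp hxc).le (by positivity)
    fun q hq hqρ => hscale Ω u h1 h2 hlow hup hdet q hq hqρ x hx
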